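/- A function $f:X\to Y$ between topological spaces is skeletal if $\mathrm{int}(f^{-1}(\mathrm{cl}\,V))\subseteq \mathrm{cl}(f^{-1}(V))$ for every open $V\subseteq Y$. It is quasi-open if it is continuous and $\mathrm{int}(f(U))\neq\emptyset$ for every non-empty open $U\subseteq X$. It is perfect if it is continuous and closed and all its point inverses are compact (surjectivity is not required). Let $\mathbf{SkePerLC}$ be the category of all locally compact Hausdorff spaces and all skeletal perfect maps. A contact relation on a Boolean algebra $B$ (where $0=1$ is allowed, and $b^*$ denotes the complement of $b$) is a binary relation $\rho$ such that: $a\neq0$ implies $a\rho a$; $a\rho b$ implies $a\ne0$ and $b\neq 0$; $a\rho b$ implies $b\rho a$; and $a\rho(b\vee c)$ iff $a\rho b$ or $a\rho c$. Write $a\ll_\rho b$ if $a\rho b^*$ does not hold. A complete local contact algebra is a triple $(B,\rho,\mathbb B)$ where $B$ is a complete Boolean algebra, $\rho$ is a contact relation on $B$, and $\mathbb B$ is a (possibly non-proper) ideal of $B$, whose elements are called bounded, such that: (BC1) if $a\in\mathbb B$, $c\in B$ and $a\ll_\rho c$, then $a\ll_\rho b\ll_\rho c$ for some $b\in\mathbb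 B$; (BC2) if $a\rho b$, then $a\rho(c\wedge b)$ for some $c\in\mathbb B$; (BC3) if $a\neq0$, then $b\ll_\rho a$ for some $b\in\mathbb B\setminus\{0\}$. Let $\mathbf{DSkePerLC}$ be the category whose objects are all complete local contact algebras and whose morphisms $\varphi:(A,\rho,\mathbb B)\to(B,\eta,\mathbb B')$ are all complete Boolean homomorphisms $\varphi:A\to B$ (i.e. Boolean homomorphisms preserving all joins and meets) such that, with $\varphi_\Lambda(b)=\bigwedge\{a\in A: b\le\varphi(a)\}$ the left adjoint of $\varphi$: (L1) for all $a,b\in A$, $\varphi(a)\,\eta\,\varphi(b)$ implies $a\rho b$; (L2) $b\in\mathbb B'$ implies $\varphi_\Lambda(b)\in\mathbb B$; (L3) $a\in\mathbb B$ implies $\varphi(a)\in\mathbb B'$. In both categories composition is the usual composition of maps. Theorem. A perfect map between locally compact Hausdorff spaces is quasi-open if and only if it is skeletal (so the morphisms of $\mathbf{SkePerLC}$ are precisely the quasi-open perfect maps), and the categories $\mathbf{SkePerLC}$ and $\mathbf{DSkePerLC}$ are dually equivalent, i.e. $\mathbf{SkePerLC}^{\mathrm{op}}$ is equivalent to $\mathbf{DSkePerLC}$.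 -/

import Mathlib

open CategoryTheory

universe u v

/-! ### Skeletal, quasi-open and perfect maps -/

/-- A function `f` is *skeletal* if `int (f⁻¹ (cl V)) ⊆ cl (f⁻¹ V)` for every open `V`. -/
def IsSkeletal {X : Type u} {Y : Type v} [TopologicalSpace X] [TopologicalSpace Y]
    (f : X → Y) : Prop :=
  ∀ V : Set Y, IsOpen V → interior (f ⁻¹' closure V) ⊆ closure (f ⁻¹' V)

/-- A continuous map is *quasi-open* if the image of every non-empty open set has
non-empty interior. -/
structure IsQuasiOpen {X : Type u} {Y : Type v} [TopologicalSpace X] [TopologicalSpace Y]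
    (f : X → Y) : Prop where
  continuous : Continuous f
  nonempty_interior_image : ∀ U : Set X, IsOpen U → U.Nonempty → (interior (f '' U)).Nonempty

/-- A *perfect* map: continuous, closed, and with compact point inverses
(not assumed to be onto). -/
structure IsPerfectMap {X : Type u} {Y : Type v} [TopologicalSpace X] [TopologicalSpace Y]
    (f : X → Y) : Prop where
  continuous : Continuous f
  isClosedMap : IsClosedMap f
  isCompact_fiber : ∀ y : Y, IsCompact (f ⁻¹' {y})

theorem IsSkeletal.id (X : Type u) [TopologicalSpace X] : IsSkeletal (fun x : X => x) :=
  fun _ _ => interior_subset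

theorem IsSkeletal.comp {X Y Z : Type u} [TopologicalSpace X] [TopologicalSpace Y]
    [TopologicalSpace Z] {g : Y → Z} {f : X → Y} (hg : IsSkeletal g) (hgc : Continuous g)
    (hf : IsSkeletal f) : IsSkeletal (fun x => g (f x)) := by
  intro V hV x hx
  rw [mem_closure_iff]
  intro O hO hxO
  by_contra hne
  -- `W` is the complement of the preimage of the boundary of `V`; it is open and dense
  have hWo : IsOpen (g ⁻¹' closure V \ g ⁻¹' V)ᶜ :=
    ((isClosed_closure.preimage hgc).sdiff (hV.preimage hgc)).isOpen_compl
  have hWd : closure (g ⁻¹' closure V \ g ⁻¹' V)ᶜ = Set.univ := by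
    rw [closure_compl, Set.compl_univ_iff, Set.eq_empty_iff_forall_notMem]
    intro y hy
    have h1 : y ∈ closure (g ⁻¹' V) :=
      hg V hV (interior_mono Set.sdiff_subset hy)
    obtain ⟨z, hz1, hz2⟩ := mem_closure_iff.1 h1 _ isOpen_interior hy
    exact (interior_subset hz1).2 hz2
  have h2 : x ∈ closure (f ⁻¹' (g ⁻¹' closure V \ g ⁻¹' V)ᶜ) := by
    apply hf _ hWo
    rw [hWd]
    simp
  obtain ⟨z, ⟨hzO, hzI⟩, hz⟩ := mem_closure_iff.1 h2 _ (hO.inter isOpen_interior) ⟨hxO, hx⟩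
  have hzI' : z ∈ (fun x => g (f x)) ⁻¹' closure V := interior_subset hzI
  exact hz ⟨hzI', fun h => hne ⟨z, hzO, h⟩⟩

theorem IsPerfectMap.id (X : Type u) [TopologicalSpace X] : IsPerfectMap (fun x : X => x) where
  continuous := continuous_id
  isClosedMap := IsClosedMap.id
  isCompact_fiber y := by
    have h : (fun x : X => x) ⁻¹' {y} = {y} := rfl
    rw [h]
    exact isCompact_singleton

theorem IsPerfectMap.comp {X Y Z : Type u} [TopologicalSpace X] [TopologicalSpace Y]
    [TopologicalSpace Z] {g : Y → Z} {f : X → Y} (hg : IsPerfectMap g) (hf : IsPerfectMap f) :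
    IsPerfectMap (fun x => g (f x)) where
  continuous := hg.continuous.comp hf.continuous
  isClosedMap := hg.isClosedMap.comp hf.isClosedMap
  isCompact_fiber z :=
    (isProperMap_iff_isClosedMap_and_compact_fibers.2
      ⟨hf.continuous, hf.isClosedMap, fun {y} => hf.isCompact_fiber y⟩).isCompact_preimage
      (hg.isCompact_fiber z)

/-! ### The category of locally compact Hausdorff spaces and skeletal perfect maps -/

/-- Objects of `SkePerLC`: the locally compact Hausdorff spaces. -/
structure SkePerLC : Type (u + 1) where
  carrier : Type u
  [topology : TopologicalSpace carrier]
  [t2 : T2Space carrier]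
  [locallyCompact : LocallyCompactSpace carrier]

namespace SkePerLC

attribute [instance] topology t2 locallyCompact

/-- Morphisms of `SkePerLC`: the skeletal perfect maps. -/
@[ext]
structure Hom (X Y : SkePerLC.{u}) : Type u where
  toFun : X.carrier → Y.carrier
  skeletal : IsSkeletal toFun
  perfect : IsPerfectMap toFun

instance : Category SkePerLC.{u} where
  Hom := Hom
  id X := ⟨fun x => x, IsSkeletal.id X.carrier, IsPerfectMap.id X.carrier⟩
  comp f g := ⟨fun x => g.toFun (f.toFun x),
    g.skeletal.comp g.perfect.continuous f.skeletal, g.perfect.comp f.perfect⟩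

end SkePerLC

/-! ### Contact algebras and local contact algebras -/

/-- `C` is a *contact relation* on the Boolean algebra `B`
(which is allowed to be trivial, i.e. `⊥ = ⊤`). -/
structure IsContactRel {B : Type u} [BooleanAlgebra B] (C : B → B → Prop) : Prop where
  refl_of_ne_bot : ∀ a, a ≠ ⊥ → C a a
  ne_bot : ∀ a b, C a b → a ≠ ⊥ ∧ b ≠ ⊥
  symm : ∀ a b, C a b → C b a
  sup_iff : ∀ a b c, C a (b ⊔ c) ↔ C a b ∨ C a c

/-- Non-tangential inclusion `a ≪ b` with respect to `C`: `a` is not in contact with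
the complement of `b`. -/
def NonTangential {B : Type u} [BooleanAlgebra B] (C : B → B → Prop) (a b : B) : Prop :=
  ¬ C a bᶜ

/-- `(B, ρ, I)` is a *local contact algebra*. The (possibly improper) ideal `I` consists of the
*bounded* elements. -/
structure IsLocalContactAlgebra {B : Type u} [BooleanAlgebra B] (ρ : B → B → Prop)
    (I : Order.Ideal B) : Prop where
  contact : IsContactRel ρ
  bc1 : ∀ a ∈ I, ∀ c, NonTangential ρ a c → ∃ b ∈ I, NonTangential ρ a b ∧ NonTangential ρ b c
  bc2 : ∀ a b, ρ a b → ∃ c ∈ I, ρ a (c ⊓ b)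
  bc3 : ∀ a, a ≠ ⊥ → ∃ b ∈ I, b ≠ ⊥ ∧ NonTangential ρ b a

/-- The left adjoint `φ_Λ` of a map `φ` preserving all meets:
`φ_Λ b` is the meet of all `a` with `b ≤ φ a`. -/
def leftAdj {A B : Type u} [CompleteBooleanAlgebra A] [CompleteBooleanAlgebra B]
    (φ : CompleteLatticeHom A B) (b : B) : A :=
  sInf {a | b ≤ φ a}

theorem leftAdj_gc {A B : Type u} [CompleteBooleanAlgebra A] [CompleteBooleanAlgebra B]
    (φ : CompleteLatticeHom A B) : GaloisConnection (leftAdj φ) φ := by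
  intro b a
  constructor
  · intro h
    have h1 : b ≤ φ (leftAdj φ b) := by
      rw [leftAdj, map_sInf]
      exact le_sInf (by rintro _ ⟨a, ha, rfl⟩; exact ha)
    exact h1.trans (OrderHomClass.mono φ h)
  · intro h
    exact sInf_le h

/-! ### The dual category -/

/-- Objects of `DSkePerLC`: the complete local contact algebras. -/
structure DSkePerLC : Type (u + 1) where
  carrier : Type u
  [completeBooleanAlgebra : CompleteBooleanAlgebra carrier]
  /-- the contact relation -/
  contact : carrier → carrier → Prop
  /-- the ideal of bounded elements -/
  bounded : Order.Ideal carrier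
  isLocalContactAlgebra : IsLocalContactAlgebra contact bounded

namespace DSkePerLC

attribute [instance] completeBooleanAlgebra

/-- The complete Boolean homomorphism `φ` is a `DSkeLC`-morphism, i.e. it satisfies (L1) and (L2).
(A map between Boolean algebras preserving all joins and all meets preserves `⊥`, `⊤` and
complements.) -/
structure IsDSkeLCMorphism {A B : DSkePerLC.{u}} (φ : CompleteLatticeHom A.carrier B.carrier) :
    Prop where
  l1 : ∀ a b, B.contact (φ a) (φ b) → A.contact a b
  l2 : ∀ b ∈ B.bounded, leftAdj φ b ∈ A.bounded

/-- Morphisms of `DSkePerLC`: the `DSkeLC`-morphisms which also satisfy (L3), i.e. send bounded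
elements to bounded elements. -/
@[ext]
structure Hom (A B : DSkePerLC.{u}) : Type u where
  toHom : CompleteLatticeHom A.carrier B.carrier
  isDSkeLCMorphism : IsDSkeLCMorphism toHom
  l3 : ∀ a ∈ A.bounded, toHom a ∈ B.bounded

/-- The identity morphism. -/
def Hom.id (A : DSkePerLC.{u}) : Hom A A where
  toHom := CompleteLatticeHom.id A.carrier
  isDSkeLCMorphism :=
    { l1 := fun _ _ h => h
      l2 := fun b hb => A.bounded.lower (sInf_le (le_refl b)) hb }
  l3 := fun _ h => h

/-- Composition of morphisms: first `φ`, then `ψ`. -/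
def Hom.comp {A B C : DSkePerLC.{u}} (φ : Hom A B) (ψ : Hom B C) : Hom A C where
  toHom := ψ.toHom.comp φ.toHom
  isDSkeLCMorphism :=
    { l1 := fun a b h => φ.isDSkeLCMorphism.l1 a b (ψ.isDSkeLCMorphism.l1 _ _ h)
      l2 := fun c hc => by
        refine A.bounded.lower ?_
          (φ.isDSkeLCMorphism.l2 _ (ψ.isDSkeLCMorphism.l2 c hc))
        refine sInf_le ?_
        exact (leftAdj_gc ψ.toHom).le_iff_le.1 ((leftAdj_gc φ.toHom).le_u_l _) }
  l3 := fun a h => ψ.l3 _ (φ.l3 a h)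

instance : Category DSkePerLC.{u} where
  Hom := Hom
  id := Hom.id
  comp := Hom.comp

end DSkePerLC

section

open TopologicalSpace Set

/-! ### Skeletal and quasi-open maps -/

/-! The duality is `RegularOpens.functor`: a space goes to its regular open sets, with contact
meaning that closures meet and bounded meaning compact closure; a map goes to `V ↦ int cl f⁻¹(V)`.
Skeletality makes this a complete homomorphism, continuity gives (L1), and properness gives (L3).

Faithfulness is Hausdorff separation. For fullness, (L2) and compactness pick for each `x` a point
`f x` with `x ∈ cl φ(V)` whenever `f x ∈ V`. (L1) sharpens this to `f⁻¹ V ⊆ φ V ⊆ f⁻¹ (cl V)`, from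
which continuity, perfectness (by (L3)), skeletality and `φ V = int cl f⁻¹(V)` follow.

For essential surjectivity, an algebra is represented on its round prime filters with bounded
elements. The prime ideal theorem provides enough of them (`exists_compl_notMem`) to read contact,
order and boundedness off the basic open sets; completeness makes every regular open set basic. -/

theorem IsQuasiOpen.isSkeletal {X : Type u} {Y : Type v} [TopologicalSpace X]
    [TopologicalSpace Y] {f : X → Y} (hf : IsQuasiOpen f) : IsSkeletal f := by
  intro V hV x hx
  rw [mem_closure_iff]
  intro O hO hxO
  obtain ⟨y, hy⟩ := hf.nonempty_interior_image _ (hO.inter isOpen_interior) ⟨x, hxO, hx⟩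
  have hyV : y ∈ closure V := by
    obtain ⟨z, hz, rfl⟩ := interior_subset hy
    exact interior_subset (s := f ⁻¹' closure V) hz.2
  obtain ⟨w, hw, hwV⟩ := mem_closure_iff.1 hyV _ isOpen_interior hy
  obtain ⟨z, hz, rfl⟩ := interior_subset hw
  exact ⟨z, hz.1, hwV⟩

/-- Take a closed neighbourhood `K` inside `U`. If `f '' K` had empty interior, its complement would
be open and dense, so skeletality would make the preimage of that complement dense; but this
preimage misses `K`. -/
theorem IsSkeletal.isQuasiOpen {X : Type u} {Y : Type v} [TopologicalSpace X] [RegularSpace X]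
    [TopologicalSpace Y] {f : X → Y} (hs : IsSkeletal f) (hc : Continuous f)
    (hf : IsClosedMap f) : IsQuasiOpen f := by
  refine ⟨hc, fun U hU ⟨x, hx⟩ => ?_⟩
  obtain ⟨K, hK, hKc, hKU⟩ := exists_mem_nhds_isClosed_subset (hU.mem_nhds hx)
  refine Set.Nonempty.mono (interior_mono (image_mono hKU)) ?_
  by_contra hne
  rw [not_nonempty_iff_eq_empty] at hne
  have hd : closure (f '' K)ᶜ = univ := by rw [closure_compl, hne, compl_empty]
  have hx' : x ∈ closure (f ⁻¹' (f '' K)ᶜ) := by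
    apply hs _ (hf K hKc).isOpen_compl
    simp [hd]
  obtain ⟨z, hz, hz'⟩ := mem_closure_iff.1 hx' _ isOpen_interior (mem_interior_iff_mem_nhds.2 hK)
  exact hz' ⟨z, interior_subset hz, rfl⟩

/-! ### The complete Boolean algebra of regular open sets -/

section ClosureInterior

variable {X : Type u} [TopologicalSpace X]

theorem closure_interior_closure_of_isOpen {s : Set X} (hs : IsOpen s) :
    closure (interior (closure s)) = closure s :=
  (closure_minimal interior_subset isClosed_closure).antisymm
    (closure_mono hs.subset_interior_closure)

end ClosureInterior

/-- The regular open sets of a topological space. -/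
def RegularOpens (X : Type u) [TopologicalSpace X] : Type u := Heyting.Regular (Opens X)

namespace RegularOpens

variable {X : Type u} [TopologicalSpace X]

instance : BooleanAlgebra (RegularOpens X) :=
  inferInstanceAs (BooleanAlgebra (Heyting.Regular (Opens X)))

instance : SetLike (RegularOpens X) X where
  coe U := ((Heyting.Regular.val U : Opens X) : Set X)
  coe_injective := SetLike.coe_injective.comp Heyting.Regular.coe_injective

theorem isOpen (U : RegularOpens X) : IsOpen (U : Set X) :=
  (Heyting.Regular.val U : Opens X).isOpen

theorem coe_subset_coe {U V : RegularOpens X} : (U : Set X) ⊆ V ↔ U ≤ V := Iff.rfl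

theorem coe_inf (U V : RegularOpens X) : ((U ⊓ V : RegularOpens X) : Set X) = ↑U ∩ ↑V := rfl

theorem coe_bot : ((⊥ : RegularOpens X) : Set X) = ∅ := rfl

theorem coe_top : ((⊤ : RegularOpens X) : Set X) = univ := rfl

theorem coe_compl (U : RegularOpens X) : ((Uᶜ : RegularOpens X) : Set X) = (closure U)ᶜ := by
  have : ((Uᶜ : RegularOpens X) : Set X) = (((Heyting.Regular.val U)ᶜ : Opens X) : Set X) := rfl
  rw [this, Opens.coe_compl_eq_interior_compl, interior_compl]
  rfl

theorem interior_closure (U : RegularOpens X) : interior (closure (U : Set X)) = U := by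
  have h := coe_compl Uᶜ
  rw [compl_compl, coe_compl, closure_compl, compl_compl] at h
  exact h.symm

theorem closure_compl (U : RegularOpens X) :
    closure ((Uᶜ : RegularOpens X) : Set X) = (U : Set X)ᶜ := by
  rw [coe_compl, _root_.closure_compl, interior_closure]

theorem ne_bot_iff {U : RegularOpens X} : U ≠ ⊥ ↔ (U : Set X).Nonempty := by
  rw [nonempty_iff_ne_empty, ← coe_bot, Ne, Ne, SetLike.coe_set_eq]

/-- The interior of the closure of a set, as a regular open set. -/
def ofSet (s : Set X) : RegularOpens X :=
  ⟨⟨interior (closure s), isOpen_interior⟩, by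
    apply SetLike.coe_injective
    rw [Opens.coe_compl_eq_interior_compl, Opens.coe_compl_eq_interior_compl]
    simp [interior_compl]⟩

theorem coe_ofSet (s : Set X) : (ofSet s : Set X) = interior (closure s) := rfl

theorem subset_ofSet {s : Set X} (hs : IsOpen s) : s ⊆ ofSet s := hs.subset_interior_closure

theorem closure_ofSet {s : Set X} (hs : IsOpen s) : closure (ofSet s : Set X) = closure s :=
  closure_interior_closure_of_isOpen hs

theorem ofSet_le_iff {s : Set X} (hs : IsOpen s) {U : RegularOpens X} :
    ofSet s ≤ U ↔ s ⊆ U := by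
  rw [← coe_subset_coe]
  constructor
  · exact (subset_ofSet hs).trans
  · intro h
    rw [← interior_closure U]
    exact interior_mono (closure_mono h)

theorem subset_iff_subset_closure {s : Set X} (hs : IsOpen s) {U : RegularOpens X} :
    s ⊆ U ↔ s ⊆ closure U := by
  rw [← interior_closure U, hs.subset_interior_iff, interior_closure]

theorem isLUB_ofSet (S : Set (RegularOpens X)) : IsLUB S (ofSet (⋃ U ∈ S, (U : Set X))) := by
  have ho : IsOpen (⋃ U ∈ S, (U : Set X)) := isOpen_biUnion fun U _ => U.isOpen
  constructor
  · intro U hU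
    rw [← coe_subset_coe]
    exact (subset_biUnion_of_mem (u := fun U : RegularOpens X => (U : Set X)) hU).trans
      (subset_ofSet ho)
  · intro V hV
    rw [ofSet_le_iff ho]
    exact iUnion₂_subset fun U hU => coe_subset_coe.2 (hV hU)

/-- Meets are taken as joins of lower bounds, so only the join has to be computed. -/
instance : CompleteBooleanAlgebra (RegularOpens X) where
  __ := (inferInstance : BooleanAlgebra (RegularOpens X))
  sSup S := ofSet (⋃ U ∈ S, (U : Set X))
  isLUB_sSup := isLUB_ofSet
  sInf S := ofSet (⋃ U ∈ lowerBounds S, (U : Set X))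
  isGLB_sInf S := isLUB_lowerBounds.1 (isLUB_ofSet (lowerBounds S))

theorem sSup_eq (S : Set (RegularOpens X)) : sSup S = ofSet (⋃ U ∈ S, (U : Set X)) := rfl

theorem closure_sup (U V : RegularOpens X) :
    closure ((U ⊔ V : RegularOpens X) : Set X) = closure U ∪ closure V := by
  have : U ⊔ V = ofSet (U ∪ V : Set X) := by
    apply eq_of_forall_ge_iff
    intro W
    rw [ofSet_le_iff (U.isOpen.union V.isOpen), sup_le_iff, union_subset_iff, coe_subset_coe,
      coe_subset_coe]
  rw [this, closure_ofSet (U.isOpen.union V.isOpen), closure_union]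

theorem disjoint_iff {U V : RegularOpens X} : Disjoint U V ↔ Disjoint (U : Set X) V := by
  rw [disjoint_iff_inf_le, ← coe_subset_coe, coe_inf, coe_bot, disjoint_iff_inf_le]
  rfl

theorem exists_between [RegularSpace X] [LocallyCompactSpace X] {K O : Set X} (hK : IsCompact K)
    (hO : IsOpen O) (hKO : K ⊆ O) :
    ∃ U : RegularOpens X, K ⊆ U ∧ closure (U : Set X) ⊆ O ∧ IsCompact (closure (U : Set X)) := by
  obtain ⟨V, hV, hKV, hVO, hVc⟩ := exists_open_between_and_isCompact_closure hK hO hKO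
  refine ⟨ofSet V, hKV.trans (subset_ofSet hV), ?_, ?_⟩ <;> rwa [closure_ofSet hV]

theorem exists_mem [RegularSpace X] [LocallyCompactSpace X] {x : X} {O : Set X}
    (hO : IsOpen O) (hx : x ∈ O) :
    ∃ U : RegularOpens X, x ∈ U ∧ closure (U : Set X) ⊆ O ∧ IsCompact (closure (U : Set X)) := by
  obtain ⟨U, hxU, hU⟩ := exists_between isCompact_singleton hO (singleton_subset_iff.2 hx)
  exact ⟨U, hxU rfl, hU⟩

theorem sSup_closure_subset_eq [RegularSpace X] [LocallyCompactSpace X] {O : Set X}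
    (hO : IsOpen O) : sSup {U : RegularOpens X | closure (U : Set X) ⊆ O} = ofSet O := by
  apply le_antisymm
  · refine sSup_le fun U (hU : closure (U : Set X) ⊆ O) => ?_
    exact coe_subset_coe.1 ((subset_closure.trans hU).trans (subset_ofSet hO))
  · rw [ofSet_le_iff hO]
    intro x hx
    obtain ⟨U, hxU, hU, -⟩ := exists_mem hO hx
    have hmem : U ∈ {U : RegularOpens X | closure (U : Set X) ⊆ O} := hU
    exact coe_subset_coe.2 (le_sSup hmem) hxU

/-- Two regular open sets are in contact when their closures meet. -/
def Contact (U V : RegularOpens X) : Prop := (closure (U : Set X) ∩ closure (V : Set X)).Nonempty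

theorem nonTangential_contact_iff {U V : RegularOpens X} :
    NonTangential Contact U V ↔ closure (U : Set X) ⊆ V := by
  rw [NonTangential, Contact, closure_compl, not_nonempty_iff_eq_empty, ← sdiff_eq,
    sdiff_eq_empty]

variable (X) in
/-- The ideal of regular open sets with compact closure. -/
def relativelyCompact : Order.Ideal (RegularOpens X) where
  carrier := {U | IsCompact (closure (U : Set X))}
  lower' _ _ h hU := hU.of_isClosed_subset isClosed_closure (closure_mono (coe_subset_coe.2 h))
  nonempty' := ⟨⊥, by simp [coe_bot]⟩
  directed' U hU V hV := ⟨U ⊔ V, by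
    rw [mem_ofPred_eq, closure_sup]; exact IsCompact.union hU hV, le_sup_left, le_sup_right⟩

theorem isContactRel_contact : IsContactRel (Contact (X := X)) where
  refl_of_ne_bot U hU := by
    rw [Contact, inter_self]
    exact (ne_bot_iff.1 hU).closure
  ne_bot U V h := by
    rw [ne_bot_iff, ne_bot_iff, ← closure_nonempty_iff, ← closure_nonempty_iff (s := (V : Set X))]
    exact ⟨h.left, h.right⟩
  symm U V h := by rwa [Contact, inter_comm]
  sup_iff U V W := by rw [Contact, closure_sup, inter_union_distrib_left, union_nonempty]; rfl

theorem isLocalContactAlgebra [T2Space X] [LocallyCompactSpace X] :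
    IsLocalContactAlgebra (Contact (X := X)) (relativelyCompact X) where
  contact := isContactRel_contact
  bc1 U hU V hUV := by
    rw [nonTangential_contact_iff] at hUV
    obtain ⟨W, hUW, hWV, hW⟩ := exists_between hU V.isOpen hUV
    exact ⟨W, hW, nonTangential_contact_iff.2 hUW, nonTangential_contact_iff.2 hWV⟩
  bc2 U V := by
    rintro ⟨x, hxU, hxV⟩
    obtain ⟨W, hxW, -, hW⟩ := exists_mem isOpen_univ (mem_univ x)
    refine ⟨W, hW, x, hxU, ?_⟩
    rw [coe_inf]
    exact W.isOpen.inter_closure ⟨hxW, hxV⟩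
  bc3 U hU := by
    obtain ⟨x, hx⟩ := ne_bot_iff.1 hU
    obtain ⟨W, hxW, hWU, hW⟩ := exists_mem U.isOpen hx
    exact ⟨W, hW, ne_bot_iff.2 ⟨x, hxW⟩, nonTangential_contact_iff.2 hWU⟩

end RegularOpens

/-! ### The contravariant functor of regular open sets -/

namespace RegularOpens

section Comap

variable {X : Type u} {Y : Type v} [TopologicalSpace X] [TopologicalSpace Y] {f : X → Y}

/-- The point where skeletality enters the functor: both join preservation and compatibility with
composition reduce to it. -/
theorem closure_preimage_ofSet (hc : Continuous f) (hs : IsSkeletal f) {W : Set Y}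
    (hW : IsOpen W) : closure (f ⁻¹' ofSet W) = closure (f ⁻¹' W) := by
  apply subset_antisymm
  · refine closure_minimal (Subset.trans ?_ (hs W hW)) isClosed_closure
    rw [((ofSet W).isOpen.preimage hc).subset_interior_iff]
    exact preimage_mono interior_subset
  · exact closure_mono (preimage_mono (subset_ofSet hW))

theorem ofSet_preimage_ofSet (hc : Continuous f) (hs : IsSkeletal f) {W : Set Y}
    (hW : IsOpen W) : ofSet (f ⁻¹' ofSet W) = ofSet (f ⁻¹' W) := by
  apply SetLike.coe_injective
  exact congrArg interior (closure_preimage_ofSet hc hs hW)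

theorem closure_ofSet_preimage_subset (hc : Continuous f) (V : RegularOpens Y) :
    closure (ofSet (f ⁻¹' V) : Set X) ⊆ f ⁻¹' closure V := by
  rw [closure_ofSet (V.isOpen.preimage hc)]
  exact closure_minimal (preimage_mono subset_closure) (isClosed_closure.preimage hc)

theorem ofSet_preimage_sSup (hc : Continuous f) (hs : IsSkeletal f)
    (S : Set (RegularOpens Y)) :
    ofSet (f ⁻¹' (sSup S : RegularOpens Y)) =
      sSup ((fun V : RegularOpens Y => ofSet (f ⁻¹' V)) '' S) := by
  have ho : IsOpen (⋃ U ∈ S, (U : Set Y)) := isOpen_biUnion fun U _ => U.isOpen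
  rw [sSup_eq S, ofSet_preimage_ofSet hc hs ho]
  apply eq_of_forall_ge_iff
  intro W
  rw [ofSet_le_iff (ho.preimage hc), sSup_le_iff, forall_mem_image, preimage_iUnion₂,
    iUnion₂_subset_iff]
  exact forall₂_congr fun U _ => (ofSet_le_iff (U.isOpen.preimage hc)).symm

/-- Disjointness needs only continuity; codisjointness is join preservation for the pair `{V, Vᶜ}`.
-/
theorem ofSet_preimage_compl (hc : Continuous f) (hs : IsSkeletal f) (V : RegularOpens Y) :
    ofSet (f ⁻¹' (Vᶜ : RegularOpens Y)) = (ofSet (f ⁻¹' V))ᶜ := by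
  symm
  apply IsCompl.compl_eq
  constructor
  · rw [disjoint_iff, disjoint_iff_inter_eq_empty, ← not_nonempty_iff_eq_empty]
    rintro ⟨x, hx, hx'⟩
    obtain ⟨y, hy, hyV⟩ := mem_closure_iff.1 (interior_subset hx) _
      (ofSet (f ⁻¹' (Vᶜ : RegularOpens Y))).isOpen hx'
    have := closure_ofSet_preimage_subset hc _ (subset_closure hy)
    rw [closure_compl] at this
    exact this hyV
  · have h := ofSet_preimage_sSup hc hs {V, Vᶜ}
    rw [sSup_pair, sup_compl_eq_top, coe_top, preimage_univ, image_pair, sSup_pair] at h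
    rw [codisjoint_iff, ← h, eq_top_iff, ← coe_subset_coe]
    exact subset_ofSet isOpen_univ

/-- The homomorphism of regular open algebras induced by a continuous skeletal map. -/
def comap (f : X → Y) (hc : Continuous f) (hs : IsSkeletal f) :
    CompleteLatticeHom (RegularOpens Y) (RegularOpens X) where
  toFun V := ofSet (f ⁻¹' V)
  map_sSup' := ofSet_preimage_sSup hc hs
  map_sInf' S := by
    have h := ofSet_preimage_sSup hc hs (compl '' S)
    rw [← compl_sInf', ofSet_preimage_compl hc hs] at h
    rw [← compl_compl (ofSet _), h, compl_sSup', image_image, image_image]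
    simp_rw [ofSet_preimage_compl hc hs, compl_compl]

end Comap

/-- The complete local contact algebra of regular open subsets of a locally compact Hausdorff
space. -/
def algebra (X : SkePerLC.{u}) : DSkePerLC.{u} where
  carrier := RegularOpens X.carrier
  contact := Contact
  bounded := relativelyCompact X.carrier
  isLocalContactAlgebra := isLocalContactAlgebra

/-- The action of the functor `RegularOpens.functor` on morphisms. -/
def algebraMap {X Y : SkePerLC.{u}} (f : SkePerLC.Hom X Y) :
    DSkePerLC.Hom (algebra Y) (algebra X) where
  toHom := comap f.toFun f.perfect.continuous f.skeletal
  isDSkeLCMorphism :=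
    { l1 := by
        rintro U V ⟨x, hxU, hxV⟩
        exact ⟨f.toFun x, closure_ofSet_preimage_subset f.perfect.continuous U hxU,
          closure_ofSet_preimage_subset f.perfect.continuous V hxV⟩
      l2 := by
        intro (U : RegularOpens X.carrier) (hU : IsCompact (closure (U : Set X.carrier)))
        -- A relatively compact `W` around the compact image of `cl U` bounds the left adjoint at
        -- `U` from above.
        obtain ⟨W, hUW, -, hW⟩ := exists_between (hU.image f.perfect.continuous) isOpen_univ
          (subset_univ _)
        refine (relativelyCompact Y.carrier).lower (sInf_le ?_) hW
        change U ≤ ofSet (f.toFun ⁻¹' W)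
        rw [← coe_subset_coe]
        refine Subset.trans ?_ (subset_ofSet (W.isOpen.preimage f.perfect.continuous))
        exact subset_closure.trans (image_subset_iff.1 hUW) }
  l3 := by
    intro (V : RegularOpens Y.carrier) (hV : IsCompact (closure (V : Set Y.carrier)))
    have hp : IsProperMap f.toFun := isProperMap_iff_isClosedMap_and_compact_fibers.2
      ⟨f.perfect.continuous, f.perfect.isClosedMap, fun {y} => f.perfect.isCompact_fiber y⟩
    exact (hp.isCompact_preimage hV).of_isClosed_subset isClosed_closure
      (closure_ofSet_preimage_subset f.perfect.continuous V)

/-- The contravariant functor sending a space to its regular open algebra. -/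
def functor : SkePerLC.{u}ᵒᵖ ⥤ DSkePerLC.{u} where
  obj X := algebra X.unop
  map f := algebraMap f.unop
  map_id X := by
    apply DSkePerLC.Hom.ext
    apply DFunLike.ext
    intro (U : RegularOpens X.unop.carrier)
    change ofSet (U : Set X.unop.carrier) = U
    exact SetLike.coe_injective (interior_closure U)
  map_comp {X Y Z} f g := by
    apply DSkePerLC.Hom.ext
    apply DFunLike.ext
    intro (U : RegularOpens X.unop.carrier)
    exact (ofSet_preimage_ofSet g.unop.perfect.continuous g.unop.skeletal
      (U.isOpen.preimage f.unop.perfect.continuous)).symm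

instance : functor.{u}.Faithful where
  map_injective {X Y} f g h := by
    apply Quiver.Hom.unop_inj
    apply SkePerLC.Hom.ext
    funext x
    by_contra hne
    obtain ⟨O, O', hO, hO', hx, hx', hd⟩ := t2_separation hne
    obtain ⟨U, hxU, hUO, -⟩ := exists_mem hO hx
    obtain ⟨V, hxV, hVO', -⟩ := exists_mem hO' hx'
    have h1 : x ∈ closure (ofSet (f.unop.toFun ⁻¹' U) : Set Y.unop.carrier) :=
      subset_closure (subset_ofSet (U.isOpen.preimage f.unop.perfect.continuous) hxU)
    have h2 : ofSet (f.unop.toFun ⁻¹' U) = ofSet (g.unop.toFun ⁻¹' U) :=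
      DFunLike.congr_fun (congrArg DSkePerLC.Hom.toHom h) U
    rw [h2] at h1
    exact hd.le_bot ⟨hUO (closure_ofSet_preimage_subset g.unop.perfect.continuous U h1),
      hVO' (subset_closure hxV)⟩

end RegularOpens

/-! ### Reconstructing a map from a homomorphism of regular open algebras -/

namespace RegularOpens

section Realize

variable {X : Type u} {Y : Type u} [TopologicalSpace X] [TopologicalSpace Y]
  {φ : CompleteLatticeHom (RegularOpens Y) (RegularOpens X)}

/-- Otherwise every `y` has a neighbourhood `V` with `x ∉ cl φ(V)`. For a relatively compact `U ∋
x`, finitely many of these cover the compact closure of `φ_Λ U`, and their join `W` satisfies `U ≤ φ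
W`, contradicting `x ∉ cl φ(W)`. -/
theorem exists_forall_mem_closure [T2Space X] [LocallyCompactSpace X]
    (h2 : ∀ U ∈ relativelyCompact X, leftAdj φ U ∈ relativelyCompact Y) (x : X) :
    ∃ y, ∀ V : RegularOpens Y, y ∈ V → x ∈ closure (φ V : Set X) := by
  obtain ⟨U, hxU, -, hU⟩ := exists_mem isOpen_univ (mem_univ x)
  by_contra! hne
  obtain ⟨W, hW, hxW⟩ : ∃ W : RegularOpens Y, closure ((leftAdj φ U : RegularOpens Y) : Set Y) ⊆ W ∧
      x ∉ closure (φ W : Set X) := by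
    refine IsCompact.induction_on (h2 U hU)
      (p := fun s => ∃ W : RegularOpens Y, s ⊆ W ∧ x ∉ closure (φ W : Set X)) ?_ ?_ ?_ ?_
    · exact ⟨⊥, empty_subset _, by simp [coe_bot]⟩
    · rintro s t hst ⟨W, hW, hxW⟩
      exact ⟨W, hst.trans hW, hxW⟩
    · rintro s t ⟨W, hW, hxW⟩ ⟨W', hW', hxW'⟩
      refine ⟨W ⊔ W', union_subset (hW.trans (coe_subset_coe.2 le_sup_left))
        (hW'.trans (coe_subset_coe.2 le_sup_right)), ?_⟩
      rw [map_sup, closure_sup]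
      exact fun h => h.elim hxW hxW'
    · intro y _
      obtain ⟨V, hyV, hxV⟩ := hne y
      exact ⟨V, mem_nhdsWithin_of_mem_nhds (V.isOpen.mem_nhds hyV), V, Subset.rfl, hxV⟩
  have hle : leftAdj φ U ≤ W := coe_subset_coe.1 (subset_closure.trans hW)
  exact hxW (subset_closure (coe_subset_coe.2 ((leftAdj_gc φ _ _).1 hle) hxU))

variable {f : X → Y} (h1 : ∀ U V, Contact (φ U) (φ V) → Contact U V)
  (hf : ∀ x (V : RegularOpens Y), f x ∈ V → x ∈ closure (φ V : Set X))

include h1 in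
theorem closure_map_subset {U V : RegularOpens Y} (h : closure (U : Set Y) ⊆ V) :
    closure (φ U : Set X) ⊆ φ V := by
  rw [← nonTangential_contact_iff] at h ⊢
  intro hC
  rw [← map_compl'] at hC
  exact h (h1 _ _ hC)

include h1 hf in
-- Shrinking `V` around `f x` to some `U ≪ V` absorbs the closure in `hf`, since `φ` preserves `≪`.
theorem preimage_subset_map [T2Space Y] [LocallyCompactSpace Y] (V : RegularOpens Y) :
    f ⁻¹' V ⊆ φ V := by
  intro x hx
  obtain ⟨U, hxU, hUV, -⟩ := exists_mem V.isOpen hx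
  exact closure_map_subset h1 hUV (hf x U hxU)

include h1 hf in
theorem closure_map_subset_preimage [T2Space Y] [LocallyCompactSpace Y]
    (V : RegularOpens Y) :
    closure (φ V : Set X) ⊆ f ⁻¹' closure V := by
  intro x hx
  by_contra hxV
  have : x ∈ φ Vᶜ := preimage_subset_map h1 hf Vᶜ (by rwa [coe_compl])
  rw [map_compl', ← SetLike.mem_coe, coe_compl] at this
  exact this hx

include h1 hf in
theorem continuous_of_forall_mem_closure [T2Space Y] [LocallyCompactSpace Y] :
    Continuous f := by
  refine continuous_def.2 fun O hO => isOpen_iff_mem_nhds.2 fun x hx => ?_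
  obtain ⟨V, hxV, hVO, -⟩ := exists_mem hO hx
  refine Filter.mem_of_superset ((φ V).isOpen.mem_nhds (preimage_subset_map h1 hf V hxV)) ?_
  exact (subset_closure.trans (closure_map_subset_preimage h1 hf V)).trans (preimage_mono hVO)

include h1 hf in
theorem isPerfectMap_of_forall_mem_closure [T2Space Y] [LocallyCompactSpace Y]
    (h3 : ∀ V ∈ relativelyCompact Y, φ V ∈ relativelyCompact X) : IsPerfectMap f := by
  have hc := continuous_of_forall_mem_closure h1 hf
  have hp : IsProperMap f := by
    refine isProperMap_iff_isCompact_preimage.2 ⟨hc, fun K hK => ?_⟩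
    obtain ⟨V, hKV, -, hV⟩ := exists_between hK isOpen_univ (subset_univ K)
    refine IsCompact.of_isClosed_subset (h3 V hV) (hK.isClosed.preimage hc) ?_
    exact ((preimage_mono hKV).trans (preimage_subset_map h1 hf V)).trans subset_closure
  exact ⟨hc, hp.isClosedMap, fun y => hp.isCompact_preimage isCompact_singleton⟩

include h1 hf in
-- Infinite joins are needed here: the regularization of `O` is the join of the regular open sets
-- whose closures lie in `O`, and `φ` of each of these lies in `f⁻¹ O`.
theorem map_ofSet_subset [T2Space Y] [LocallyCompactSpace Y] {O : Set Y} (hO : IsOpen O) :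
    (φ (ofSet O) : Set X) ⊆ closure (f ⁻¹' O) := by
  have hle : φ (ofSet O) ≤ ofSet (f ⁻¹' O) := by
    rw [← sSup_closure_subset_eq hO, map_sSup, sSup_le_iff, forall_mem_image]
    intro U (hU : closure (U : Set Y) ⊆ O)
    refine coe_subset_coe.1 (Subset.trans ?_ (subset_ofSet
      (hO.preimage (continuous_of_forall_mem_closure h1 hf))))
    exact (subset_closure.trans (closure_map_subset_preimage h1 hf U)).trans (preimage_mono hU)
  exact (coe_subset_coe.2 hle).trans interior_subset

include h1 hf in
theorem isSkeletal_of_forall_mem_closure [T2Space Y] [LocallyCompactSpace Y] :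
    IsSkeletal f := by
  intro O hO
  -- `(ofSet O)ᶜ` is the regularization of the exterior of `O`, whose preimage misses `f⁻¹ (cl O)`.
  have h : Disjoint (interior (f ⁻¹' closure O)) (φ (ofSet O)ᶜ) := by
    have hsub : (φ (ofSet O)ᶜ : Set X) ⊆ closure (f ⁻¹' (closure O)ᶜ) := by
      have := map_ofSet_subset h1 hf (O := (closure O)ᶜ) isClosed_closure.isOpen_compl
      convert this using 3
      apply SetLike.coe_injective
      rw [coe_compl, closure_ofSet hO, coe_ofSet, _root_.closure_compl, interior_compl,
        closure_interior_closure_of_isOpen hO]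
    refine Disjoint.mono_right hsub ?_
    refine Disjoint.closure_right ?_ isOpen_interior
    exact Disjoint.mono_left interior_subset
      (by rw [preimage_compl]; exact disjoint_compl_right)
  rw [map_compl', coe_compl, disjoint_compl_right_iff_subset] at h
  refine h.trans (closure_minimal ?_ isClosed_closure)
  exact map_ofSet_subset h1 hf hO

include h1 hf in
theorem ofSet_preimage_eq_map [T2Space Y] [LocallyCompactSpace Y] (V : RegularOpens Y) :
    ofSet (f ⁻¹' V) = φ V := by
  apply le_antisymm
  · rw [ofSet_le_iff (V.isOpen.preimage (continuous_of_forall_mem_closure h1 hf))]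
    exact preimage_subset_map h1 hf V
  · have h := map_ofSet_subset h1 hf V.isOpen
    rw [show ofSet (V : Set Y) = V from SetLike.coe_injective V.interior_closure] at h
    rw [← coe_subset_coe, coe_ofSet, (φ V).isOpen.subset_interior_iff]
    exact h

end Realize

instance : functor.{u}.Full where
  map_surjective {X Y} φ := by
    choose f hf using exists_forall_mem_closure (X := Y.unop.carrier) (Y := X.unop.carrier)
      (φ := φ.toHom) φ.isDSkeLCMorphism.l2
    have h1 : ∀ U V : RegularOpens X.unop.carrier, Contact (X := Y.unop.carrier) (φ.toHom U)
      (φ.toHom V) → Contact U V := φ.isDSkeLCMorphism.l1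
    refine ⟨Quiver.Hom.op (SkePerLC.Hom.mk f (isSkeletal_of_forall_mem_closure h1 hf)
      (isPerfectMap_of_forall_mem_closure h1 hf φ.l3)), ?_⟩
    apply DSkePerLC.Hom.ext
    apply DFunLike.ext
    exact ofSet_preimage_eq_map h1 hf

end RegularOpens

/-! ### The space of points of a local contact algebra -/

namespace IsContactRel

variable {B : Type u} [BooleanAlgebra B] {C : B → B → Prop}

theorem mono (h : IsContactRel C) {a b c d : B} (hab : C a b) (hac : a ≤ c) (hbd : b ≤ d) :
    C c d := by
  have h1 : C a d := by
    rw [← sup_eq_right.2 hbd, h.sup_iff]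
    exact Or.inl hab
  apply h.symm
  rw [← sup_eq_right.2 hac, h.sup_iff]
  exact Or.inl (h.symm _ _ h1)

theorem nonTangential_mono (h : IsContactRel C) {a b c d : B} (hab : NonTangential C a b)
    (hca : c ≤ a) (hbd : b ≤ d) : NonTangential C c d :=
  fun hcd => hab (h.mono hcd hca (compl_le_compl hbd))

theorem le_of_nonTangential (h : IsContactRel C) {a b : B} (hab : NonTangential C a b) :
    a ≤ b := by
  by_contra hle
  have hne : a ⊓ bᶜ ≠ ⊥ := fun h0 => hle (by
    rwa [← disjoint_iff, disjoint_compl_right_iff] at h0)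
  exact hab (h.mono (h.refl_of_ne_bot _ hne) inf_le_left inf_le_right)

theorem nonTangential_inf (h : IsContactRel C) {a b c : B} (hb : NonTangential C a b)
    (hc : NonTangential C a c) : NonTangential C a (b ⊓ c) := by
  rw [NonTangential, compl_inf, h.sup_iff]
  exact not_or.2 ⟨hb, hc⟩

theorem nonTangential_inf_inf (h : IsContactRel C) {a b c d : B} (hab : NonTangential C a b)
    (hcd : NonTangential C c d) : NonTangential C (a ⊓ c) (b ⊓ d) :=
  h.nonTangential_inf (h.nonTangential_mono hab inf_le_left le_rfl)
    (h.nonTangential_mono hcd inf_le_right le_rfl)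

theorem nonTangential_top (h : IsContactRel C) (a : B) : NonTangential C a ⊤ := fun hC =>
  (h.ne_bot _ _ hC).2 compl_top

end IsContactRel

/-- A *point* of a local contact algebra is a round prime filter with bounded elements. -/
structure ContactPoint {B : Type u} [BooleanAlgebra B] (ρ : B → B → Prop)
    (I : Order.Ideal B) : Type u where
  carrier : Set B
  bot_notMem : ⊥ ∉ carrier
  upper : ∀ a b, a ∈ carrier → a ≤ b → b ∈ carrier
  inf_mem : ∀ a b, a ∈ carrier → b ∈ carrier → a ⊓ b ∈ carrier
  round : ∀ a ∈ carrier, ∃ b ∈ carrier, b ∈ I ∧ NonTangential ρ b a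
  prime : ∀ a b, NonTangential ρ a b → aᶜ ∈ carrier ∨ b ∈ carrier

namespace ContactPoint

section Boolean

variable {B : Type u} [BooleanAlgebra B] {ρ : B → B → Prop} {I : Order.Ideal B}

theorem carrier_injective : Function.Injective (carrier : ContactPoint ρ I → Set B) := by
  rintro ⟨p, _, _, _, _, _⟩ ⟨q, _, _, _, _, _⟩ (rfl : p = q)
  rfl

theorem compl_notMem (p : ContactPoint ρ I) {a : B} (ha : a ∈ p.carrier) : aᶜ ∉ p.carrier :=
  fun h => p.bot_notMem (by simpa using p.inf_mem _ _ ha h)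

theorem inf_ne_bot (p : ContactPoint ρ I) {a b : B} (ha : a ∈ p.carrier) (hb : b ∈ p.carrier) :
    a ⊓ b ≠ ⊥ := fun h => p.bot_notMem (h ▸ p.inf_mem _ _ ha hb)

/-- The basic open set of points containing a given element. -/
def basicOpen (ρ : B → B → Prop) (I : Order.Ideal B) (a : B) : Set (ContactPoint ρ I) :=
  {p | a ∈ p.carrier}

theorem basicOpen_mono {a b : B} (h : a ≤ b) : basicOpen ρ I a ⊆ basicOpen ρ I b :=
  fun p hp => p.upper _ _ hp h

theorem basicOpen_inf (a b : B) :
    basicOpen ρ I (a ⊓ b) = basicOpen ρ I a ∩ basicOpen ρ I b :=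
  subset_antisymm (subset_inter (basicOpen_mono inf_le_left) (basicOpen_mono inf_le_right))
    fun p hp => p.inf_mem _ _ hp.1 hp.2

instance : TopologicalSpace (ContactPoint ρ I) :=
  TopologicalSpace.generateFrom (range (basicOpen ρ I))

theorem isOpen_basicOpen (a : B) : IsOpen (basicOpen ρ I a) :=
  TopologicalSpace.isOpen_generateFrom_of_mem ⟨a, rfl⟩

theorem top_mem (h : IsContactRel ρ) (p : ContactPoint ρ I) : ⊤ ∈ p.carrier :=
  (p.prime _ _ (h.nonTangential_top ⊤)).elim (fun h0 => p.upper _ _ h0 le_top) id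

theorem basicOpen_bot : basicOpen ρ I ⊥ = ∅ :=
  eq_empty_of_forall_notMem fun p => p.bot_notMem

theorem disjoint_basicOpen_compl (a : B) :
    Disjoint (basicOpen ρ I a) (basicOpen ρ I aᶜ) :=
  Set.disjoint_left.2 fun p hp => p.compl_notMem hp

/-- If `a ∈ p` and `a ∉ q`, roundness gives `b ∈ p` with `b ≪ a`, and primality of `q` then forces
`bᶜ ∈ q`. -/
instance : T2Space (ContactPoint ρ I) where
  t2 := by
    have key : ∀ p q : ContactPoint ρ I, ¬ p.carrier ⊆ q.carrier →
        ∃ a, p ∈ basicOpen ρ I a ∧ q ∈ basicOpen ρ I aᶜ := by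
      intro p q hpq
      obtain ⟨a, hap, haq⟩ := not_subset.1 hpq
      obtain ⟨b, hbp, -, hba⟩ := p.round a hap
      exact ⟨b, hbp, (q.prime b a hba).resolve_right haq⟩
    intro p q hpq
    by_cases hle : p.carrier ⊆ q.carrier
    · obtain ⟨a, hq, hp⟩ := key q p fun hle' => hpq (carrier_injective (hle.antisymm hle'))
      exact ⟨_, _, isOpen_basicOpen _, isOpen_basicOpen _, hp, hq,
        (disjoint_basicOpen_compl a).symm⟩
    · obtain ⟨a, hp, hq⟩ := key p q hle
      exact ⟨_, _, isOpen_basicOpen _, isOpen_basicOpen _, hp, hq, disjoint_basicOpen_compl a⟩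

theorem isTopologicalBasis (h : IsContactRel ρ) :
    IsTopologicalBasis (range (basicOpen ρ I)) where
  exists_subset_inter := by
    rintro _ ⟨a, rfl⟩ _ ⟨b, rfl⟩ p hp
    exact ⟨_, ⟨a ⊓ b, rfl⟩, by rwa [basicOpen_inf], (basicOpen_inf a b).subset⟩
  sUnion_eq := eq_univ_of_forall fun p => ⟨_, ⟨⊤, rfl⟩, p.top_mem h⟩
  eq_generateFrom := rfl

theorem exists_basicOpen_subset (h : IsContactRel ρ) {O : Set (ContactPoint ρ I)}
    (hO : IsOpen O) {p : ContactPoint ρ I} (hp : p ∈ O) :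
    ∃ a ∈ p.carrier, basicOpen ρ I a ⊆ O := by
  obtain ⟨_, ⟨a, rfl⟩, ha, haO⟩ := (isTopologicalBasis h).exists_subset_of_mem_open hp hO
  exact ⟨a, ha, haO⟩

/-- The point of all elements non-tangentially containing a bounded member of a given filter. -/
def ofFilter (h : IsLocalContactAlgebra ρ I) (u : Set B) (bot_notMem : ⊥ ∉ u)
    (inf_mem : ∀ a b, a ∈ u → b ∈ u → a ⊓ b ∈ u) (exists_bounded : ∃ e ∈ u, e ∈ I)
    (prime : ∀ a b, NonTangential ρ a b → aᶜ ∈ u ∨ b ∈ u) : ContactPoint ρ I where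
  carrier := {a | ∃ c ∈ u, c ∈ I ∧ NonTangential ρ c a}
  bot_notMem := by
    rintro ⟨c, hc, -, hc0⟩
    exact bot_notMem (le_bot_iff.1 (h.contact.le_of_nonTangential hc0) ▸ hc)
  upper := by
    rintro a b ⟨c, hc, hcI, hca⟩ hab
    exact ⟨c, hc, hcI, h.contact.nonTangential_mono hca le_rfl hab⟩
  inf_mem := by
    rintro a b ⟨c, hc, hcI, hca⟩ ⟨d, hd, -, hdb⟩
    exact ⟨c ⊓ d, inf_mem _ _ hc hd, I.lower inf_le_left hcI,
      h.contact.nonTangential_inf_inf hca hdb⟩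
  round := by
    rintro a ⟨c, hc, hcI, hca⟩
    obtain ⟨d, hdI, hcd, hda⟩ := h.bc1 c hcI a hca
    exact ⟨d, ⟨c, hc, hcI, hcd⟩, hdI, hda⟩
  prime a b hab := by
    obtain ⟨e, heu, heI⟩ := exists_bounded
    -- `a` may be unbounded, so (BC1) is applied to `a ⊓ e'`; the part of `a` outside `e'` is
    -- harmless because `e ≪ e'`.
    obtain ⟨e', he'I, hee', -⟩ := h.bc1 e heI ⊤ (h.contact.nonTangential_top e)
    obtain ⟨d, hdI, hed, hdb⟩ := h.bc1 (a ⊓ e') (I.lower inf_le_right he'I) b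
      (h.contact.nonTangential_mono hab inf_le_left le_rfl)
    obtain ⟨c, hcI, hdc, hcb⟩ := h.bc1 d hdI b hdb
    rcases prime d c hdc with hd | hc
    · refine Or.inl ⟨dᶜ ⊓ e, inf_mem _ _ hd heu, I.lower inf_le_right heI, fun hC => ?_⟩
      have hle : aᶜᶜ ≤ (a ⊓ e') ⊔ e'ᶜ := by
        rw [compl_compl, sup_inf_right, sup_compl_eq_top, inf_top_eq]
        exact le_sup_left
      rcases (h.contact.sup_iff _ _ _).1 (h.contact.mono hC le_rfl hle) with hC | hC
      · exact hed (h.contact.symm _ _ (h.contact.mono hC inf_le_left le_rfl))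
      · exact hee' (h.contact.mono hC inf_le_right le_rfl)
    · exact Or.inr ⟨c, hc, hcI, hcb⟩

/-- (BC2) replaces `a` by a bounded `c ⊓ a` still in contact with `b`. A prime ideal containing
everything not in contact with `b` and avoiding `c ⊓ a` has as complement an ultrafilter with a
bounded member, and this yields the point. -/
theorem exists_compl_notMem (h : IsLocalContactAlgebra ρ I) {a b : B} (hab : ρ a b) :
    ∃ p : ContactPoint ρ I, aᶜ ∉ p.carrier ∧ bᶜ ∉ p.carrier := by
  obtain ⟨c, hcI, hbc⟩ := h.bc2 b a (h.contact.symm _ _ hab)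
  let J : Order.Ideal B :=
    { carrier := {x | ¬ ρ b x}
      lower' := fun x y hyx hx hy => hx (h.contact.mono hy le_rfl hyx)
      nonempty' := ⟨⊥, fun hC => (h.contact.ne_bot _ _ hC).2 rfl⟩
      directed' := fun x hx y hy =>
        ⟨x ⊔ y, fun hC => ((h.contact.sup_iff _ _ _).1 hC).elim hx hy, le_sup_left,
          le_sup_right⟩ }
  have hd : Disjoint (Order.PFilter.principal (c ⊓ a) : Set B) (J : Set B) := by
    rw [Set.disjoint_left]
    intro x hx hxJ
    exact hxJ (h.contact.mono hbc le_rfl (Order.PFilter.mem_principal.1 hx))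
  obtain ⟨P, hP, hJP, hdP⟩ := DistribLattice.prime_ideal_of_disjoint_filter_ideal hd
  have hca : c ⊓ a ∉ P := Set.disjoint_left.1 hdP (Order.PFilter.mem_principal.2 le_rfl)
  refine ⟨ofFilter h (P : Set B)ᶜ (fun h0 => h0 P.bot_mem)
    (fun x y hx hy hxy => (hP.mem_or_mem hxy).elim hx hy)
    ⟨c ⊓ a, hca, I.lower inf_le_left hcI⟩ ?_, ?_, ?_⟩
  · intro x y hxy
    by_contra hne
    rw [not_or] at hne
    simp only [Set.mem_compl_iff, not_not, SetLike.mem_coe] at hne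
    refine hca (P.lower ?_ (Order.Ideal.sup_mem hne.1 hne.2))
    calc c ⊓ a ≤ xᶜ ⊔ x := by rw [compl_sup_eq_top]; exact le_top
      _ ≤ xᶜ ⊔ y := sup_le_sup_left (h.contact.le_of_nonTangential hxy) _
  · rintro ⟨d, hd, -, hda⟩
    refine (hP.mem_or_mem (x := d) (y := c ⊓ a) ?_).elim hd hca
    have : d ⊓ (c ⊓ a) = ⊥ := by
      rw [← disjoint_iff]
      exact (le_compl_iff_disjoint_right.1 (h.contact.le_of_nonTangential hda)).mono_right
        inf_le_right
    rw [this]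
    exact P.bot_mem
  · rintro ⟨d, hd, -, hdb⟩
    rw [NonTangential, compl_compl] at hdb
    exact hd (hJP fun hC => hdb (h.contact.symm _ _ hC))

theorem contact_iff (h : IsLocalContactAlgebra ρ I) {a b : B} :
    ρ a b ↔ ∃ p : ContactPoint ρ I, aᶜ ∉ p.carrier ∧ bᶜ ∉ p.carrier := by
  refine ⟨exists_compl_notMem h, ?_⟩
  rintro ⟨p, ha, hb⟩
  by_contra hC
  exact (p.prime a bᶜ (by rwa [NonTangential, compl_compl])).elim ha hb

/-- (BC3) gives a nonzero `b ≪ a`; a point witnessing the contact of `b` with itself contains `a` by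
primality. -/
theorem basicOpen_nonempty (h : IsLocalContactAlgebra ρ I) {a : B} (ha : a ≠ ⊥) :
    (basicOpen ρ I a).Nonempty := by
  obtain ⟨b, -, hb, hba⟩ := h.bc3 a ha
  obtain ⟨p, hp, -⟩ := exists_compl_notMem h (h.contact.refl_of_ne_bot b hb)
  exact ⟨p, (p.prime b a hba).resolve_left hp⟩

theorem closure_basicOpen (h : IsLocalContactAlgebra ρ I) (a : B) :
    closure (basicOpen ρ I a) = {p | aᶜ ∉ p.carrier} := by
  ext p
  rw [mem_closure_iff]
  constructor
  · intro hp hap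
    obtain ⟨q, hq, hqa⟩ := hp _ (isOpen_basicOpen aᶜ) hap
    exact q.compl_notMem hqa hq
  · intro (hp : aᶜ ∉ p.carrier) O hO hpO
    obtain ⟨c, hc, hcO⟩ := exists_basicOpen_subset h.contact hO hpO
    have hca : c ⊓ a ≠ ⊥ := fun h0 =>
      hp (p.upper _ _ hc (le_compl_iff_disjoint_right.2 (disjoint_iff.2 h0)))
    refine (basicOpen_nonempty h hca).mono ?_
    rw [basicOpen_inf]
    exact inter_subset_inter_left _ hcO

/-- The elements whose basic open sets belong to an ultrafilter on the closure satisfy the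
hypotheses of `ofFilter`; the bounded member is some `e` with `b ≪ e`. The resulting point is a
limit of the ultrafilter. -/
theorem isCompact_closure_basicOpen (h : IsLocalContactAlgebra ρ I) {b : B} (hb : b ∈ I) :
    IsCompact (closure (basicOpen ρ I b)) := by
  rw [isCompact_iff_ultrafilter_le_nhds]
  intro F hF
  rw [closure_basicOpen h, Filter.le_principal_iff] at hF
  obtain ⟨e, heI, hbe, -⟩ := h.bc1 b hb ⊤ (h.contact.nonTangential_top b)
  have hp : ∀ x y, NonTangential ρ x y → basicOpen ρ I xᶜ ∈ F ∨ basicOpen ρ I y ∈ F := by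
    intro x y hxy
    rw [← Ultrafilter.union_mem_iff]
    exact Filter.mem_of_superset Filter.univ_mem fun p _ => p.prime x y hxy
  let p := ofFilter h {x | basicOpen ρ I x ∈ F}
    (fun h0 => F.empty_notMem (by
      rw [mem_ofPred_eq, basicOpen_bot] at h0; exact h0))
    (fun x y hx hy => by
      rw [mem_ofPred_eq, basicOpen_inf]; exact Filter.inter_mem hx hy)
    ⟨e, Filter.mem_of_superset hF fun p hp => (p.prime b e hbe).resolve_left hp, heI⟩ hp
  have hmem : ∀ a ∈ p.carrier, basicOpen ρ I a ∈ F := by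
    rintro a ⟨c, hc, -, hca⟩
    exact Filter.mem_of_superset hc (basicOpen_mono (h.contact.le_of_nonTangential hca))
  refine ⟨p, ?_, ?_⟩
  · rw [closure_basicOpen h]
    intro hbp
    obtain ⟨q, hq, hq'⟩ := F.nonempty_of_mem (Filter.inter_mem (hmem _ hbp) hF)
    exact hq' hq
  · intro s hs
    obtain ⟨O, hOs, hO, hpO⟩ := mem_nhds_iff.1 hs
    obtain ⟨a, ha, haO⟩ := exists_basicOpen_subset h.contact hO hpO
    exact Filter.mem_of_superset (hmem a ha) (haO.trans hOs)

theorem locallyCompactSpace (h : IsLocalContactAlgebra ρ I) :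
    LocallyCompactSpace (ContactPoint ρ I) := by
  have : WeaklyLocallyCompactSpace (ContactPoint ρ I) := ⟨fun p => by
    obtain ⟨b, hb, hbI, -⟩ := p.round ⊤ (p.top_mem h.contact)
    exact ⟨_, isCompact_closure_basicOpen h hbI,
      Filter.mem_of_superset ((isOpen_basicOpen b).mem_nhds hb) subset_closure⟩⟩
  infer_instance

theorem le_of_basicOpen_subset_closure (h : IsLocalContactAlgebra ρ I) {a b : B}
    (hab : basicOpen ρ I a ⊆ closure (basicOpen ρ I b)) : a ≤ b := by
  by_contra hle
  have hne : a ⊓ bᶜ ≠ ⊥ := fun h0 => hle (by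
    rwa [← disjoint_iff, disjoint_compl_right_iff] at h0)
  obtain ⟨p, hp⟩ := basicOpen_nonempty h hne
  rw [closure_basicOpen h] at hab
  exact hab (basicOpen_mono inf_le_left hp) (basicOpen_mono inf_le_right hp)

theorem interior_closure_basicOpen (h : IsLocalContactAlgebra ρ I) (a : B) :
    interior (closure (basicOpen ρ I a)) = basicOpen ρ I a := by
  refine subset_antisymm (fun p hp => ?_) (isOpen_basicOpen a).subset_interior_closure
  obtain ⟨b, hb, hba⟩ := exists_basicOpen_subset h.contact isOpen_interior hp
  exact p.upper _ _ hb (le_of_basicOpen_subset_closure h (hba.trans interior_subset))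

/-- Every point contains a bounded element, so a compact closure is covered by finitely many bounded
basic open sets; their join is bounded and dominates `a`. -/
theorem isCompact_closure_basicOpen_iff (h : IsLocalContactAlgebra ρ I) {a : B} :
    IsCompact (closure (basicOpen ρ I a)) ↔ a ∈ I := by
  refine ⟨fun hK => ?_, isCompact_closure_basicOpen h⟩
  obtain ⟨b, hbI, hb⟩ : ∃ b ∈ I, closure (basicOpen ρ I a) ⊆ basicOpen ρ I b := by
    refine hK.induction_on (p := fun s => ∃ b ∈ I, s ⊆ basicOpen ρ I b)
      ⟨⊥, I.bot_mem, empty_subset _⟩ ?_ ?_ ?_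
    · rintro s t hst ⟨b, hb, htb⟩
      exact ⟨b, hb, hst.trans htb⟩
    · rintro s t ⟨b, hb, hsb⟩ ⟨c, hc, htc⟩
      exact ⟨b ⊔ c, Order.Ideal.sup_mem hb hc, union_subset
        (hsb.trans (basicOpen_mono le_sup_left)) (htc.trans (basicOpen_mono le_sup_right))⟩
    · intro p _
      obtain ⟨b, hb, hbI, -⟩ := p.round ⊤ (p.top_mem h.contact)
      exact ⟨basicOpen ρ I b, mem_nhdsWithin_of_mem_nhds ((isOpen_basicOpen b).mem_nhds hb), b,
        hbI, Subset.rfl⟩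
  exact I.lower (le_of_basicOpen_subset_closure h
    ((subset_closure.trans hb).trans subset_closure)) hbI

theorem closure_basicOpen_inter_nonempty_iff (h : IsLocalContactAlgebra ρ I) {a b : B} :
    (closure (basicOpen ρ I a) ∩ closure (basicOpen ρ I b)).Nonempty ↔ ρ a b := by
  rw [contact_iff h, closure_basicOpen h, closure_basicOpen h]
  rfl

/-- A basic open set, as a regular open set. -/
def basicRegularOpen (ρ : B → B → Prop) (I : Order.Ideal B) (a : B) :
    RegularOpens (ContactPoint ρ I) :=
  RegularOpens.ofSet (basicOpen ρ I a)

theorem coe_basicRegularOpen (h : IsLocalContactAlgebra ρ I) (a : B) :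
    (basicRegularOpen ρ I a : Set (ContactPoint ρ I)) = basicOpen ρ I a :=
  interior_closure_basicOpen h a

theorem basicRegularOpen_le_iff (h : IsLocalContactAlgebra ρ I) {a b : B} :
    basicRegularOpen ρ I a ≤ basicRegularOpen ρ I b ↔ a ≤ b := by
  rw [← RegularOpens.coe_subset_coe, coe_basicRegularOpen h, coe_basicRegularOpen h]
  exact ⟨fun hab => le_of_basicOpen_subset_closure h (hab.trans subset_closure), basicOpen_mono⟩

end Boolean

section Complete

variable {B : Type u} [CompleteBooleanAlgebra B] {ρ : B → B → Prop} {I : Order.Ideal B}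

theorem basicRegularOpen_surjective (h : IsLocalContactAlgebra ρ I) :
    Function.Surjective (basicRegularOpen ρ I) := by
  intro U
  let S : Set B := {c | basicOpen ρ I c ⊆ U}
  refine ⟨sSup S, le_antisymm ?_ ?_⟩
  · rw [← RegularOpens.coe_subset_coe,
      RegularOpens.subset_iff_subset_closure (RegularOpens.isOpen _), coe_basicRegularOpen h]
    intro p hp
    rw [mem_closure_iff]
    intro O hO hpO
    obtain ⟨b, hb, hbO⟩ := exists_basicOpen_subset h.contact hO hpO
    have hne := p.inf_ne_bot hb hp
    -- Since meets distribute over arbitrary joins, `b` meets some single `c ∈ S`.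
    rw [inf_sSup_eq, Ne, iSup₂_eq_bot] at hne
    push Not at hne
    obtain ⟨c, hc, hbc⟩ := hne
    refine (basicOpen_nonempty h hbc).mono ?_
    rw [basicOpen_inf]
    exact inter_subset_inter hbO hc
  · rw [← RegularOpens.coe_subset_coe, coe_basicRegularOpen h]
    intro p hp
    obtain ⟨a, ha, haU⟩ := exists_basicOpen_subset h.contact U.isOpen hp
    exact basicOpen_mono (le_sSup (show a ∈ S from haU)) ha

/-- A complete local contact algebra is isomorphic to the regular open algebra of its space of
points. -/
noncomputable def orderIso (h : IsLocalContactAlgebra ρ I) :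
    B ≃o RegularOpens (ContactPoint ρ I) where
  toEquiv := Equiv.ofBijective (basicRegularOpen ρ I)
    ⟨fun _ _ hab => le_antisymm ((basicRegularOpen_le_iff h).1 hab.le)
      ((basicRegularOpen_le_iff h).1 hab.ge), basicRegularOpen_surjective h⟩
  map_rel_iff' := basicRegularOpen_le_iff h

theorem coe_orderIso (h : IsLocalContactAlgebra ρ I) (a : B) :
    (orderIso h a : Set (ContactPoint ρ I)) = basicOpen ρ I a :=
  coe_basicRegularOpen h a

end Complete

end ContactPoint

/-! ### Essential surjectivity -/

namespace DSkePerLC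

/-- A morphism coming from an order isomorphism that respects contact and boundedness. -/
def Hom.ofOrderIso {A B : DSkePerLC.{u}} (e : A.carrier ≃o B.carrier)
    (hc : ∀ a b, B.contact (e a) (e b) ↔ A.contact a b)
    (hb : ∀ a, e a ∈ B.bounded ↔ a ∈ A.bounded) : Hom A B where
  toHom := CompleteLatticeHom.mk ⟨e, map_sInf e⟩ (map_sSup e)
  isDSkeLCMorphism :=
    { l1 := fun a b => (hc a b).1
      l2 := fun b h => A.bounded.lower (sInf_le (e.apply_symm_apply b).ge)
        ((hb _).1 (by rwa [e.apply_symm_apply])) }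
  l3 := fun a => (hb a).2

/-- An isomorphism coming from an order isomorphism that respects contact and boundedness. -/
def isoOfOrderIso {A B : DSkePerLC.{u}} (e : A.carrier ≃o B.carrier)
    (hc : ∀ a b, B.contact (e a) (e b) ↔ A.contact a b)
    (hb : ∀ a, e a ∈ B.bounded ↔ a ∈ A.bounded) : A ≅ B where
  hom := Hom.ofOrderIso e hc hb
  inv := Hom.ofOrderIso e.symm
    (fun a b => by rw [← hc, e.apply_symm_apply, e.apply_symm_apply])
    (fun a => by rw [← hb, e.apply_symm_apply])
  hom_inv_id := Hom.ext (DFunLike.ext _ _ e.symm_apply_apply)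
  inv_hom_id := Hom.ext (DFunLike.ext _ _ e.apply_symm_apply)

/-- The space of points of a complete local contact algebra. -/
def pointSpace (A : DSkePerLC.{u}) : SkePerLC.{u} :=
  have : LocallyCompactSpace (ContactPoint A.contact A.bounded) :=
    ContactPoint.locallyCompactSpace A.isLocalContactAlgebra
  ⟨ContactPoint A.contact A.bounded⟩

/-- A complete local contact algebra is isomorphic to the regular open algebra of its space of
points. -/
noncomputable def isoAlgebraPointSpace (A : DSkePerLC.{u}) :
    A ≅ RegularOpens.algebra A.pointSpace :=
  isoOfOrderIso (B := RegularOpens.algebra A.pointSpace)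
    (ContactPoint.orderIso A.isLocalContactAlgebra)
    (fun a b => by
      change (closure (ContactPoint.orderIso A.isLocalContactAlgebra a :
        Set (ContactPoint A.contact A.bounded)) ∩ closure (ContactPoint.orderIso
          A.isLocalContactAlgebra b : Set (ContactPoint A.contact A.bounded))).Nonempty ↔ _
      rw [ContactPoint.coe_orderIso, ContactPoint.coe_orderIso,
        ContactPoint.closure_basicOpen_inter_nonempty_iff A.isLocalContactAlgebra])
    (fun a => by
      change IsCompact (closure (ContactPoint.orderIso A.isLocalContactAlgebra a :
        Set (ContactPoint A.contact A.bounded))) ↔ _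
      rw [ContactPoint.coe_orderIso,
        ContactPoint.isCompact_closure_basicOpen_iff A.isLocalContactAlgebra])

end DSkePerLC

instance RegularOpens.functor_essSurj : RegularOpens.functor.{u}.EssSurj where
  mem_essImage A := ⟨Opposite.op A.pointSpace, ⟨A.isoAlgebraPointSpace.symm⟩⟩

end

theorem theorem2p15 :
    (∀ (X Y : Type u) [TopologicalSpace X] [T2Space X] [LocallyCompactSpace X]
        [TopologicalSpace Y] [T2Space Y] [LocallyCompactSpace Y] (f : X → Y),
        IsPerfectMap f → (IsQuasiOpen f ↔ IsSkeletal f)) ∧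
      Nonempty (SkePerLC.{u}ᵒᵖ ≌ DSkePerLC.{u}) := by
  refine ⟨fun X Y _ _ _ _ _ _ f hf => ?_, ?_⟩
  · exact ⟨IsQuasiOpen.isSkeletal, fun hs => hs.isQuasiOpen hf.continuous hf.isClosedMap⟩
  · have : RegularOpens.functor.{u}.IsEquivalence := {}
    exact ⟨RegularOpens.functor.asEquivalence⟩
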